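/- All graphs are finite and simple. For a graph $G$, let $P(G,x)$ denote its chromatic polynomial, i.e. the unique real polynomial such that, for every positive integer $k$, $P(G,k)$ is the number of proper $k$-colourings of $G$; and put $\epsilon(G,x)=P'(G,x)/P(G,x)$, where $P'$ is the derivative with respect to $x$. A graph $Q$ is chordal if no cycle $C$ of $Q$ with at least four vertices is an induced subgraph of $Q$ (equivalently, every such cycle has a chord). Theorem. Let $G$ be a graph and let $Q$ be a chordal and proper spanning subgraph of $G$ (that is, $V(Q)=V(G)$ and $E(Q)\subsetneq E(G)$). Then for all real $x<0$ both $P(G,x)$ and $P(Q,x)$ are non-zero (so that $\epsilon(G,x)$ and $\epsilon(Q,x)$ are defined) and $$\epsilon(G,x)>\epsilon(Q,x).$$ -/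

import Mathlib

namespace SimpleGraph

/-- The number of maps `V → Fin k` that are constant on the edges of a finite graph `H` is
`k ^ c`, where `c` is the number of connected components of `H`. -/
theorem card_maps_constant_on_edges {V : Type*} [Finite V] (H : SimpleGraph V) (k : ℕ) :
    Nat.card {f : V → Fin k // ∀ u v, H.Adj u v → f u = f v} =
      k ^ Nat.card H.ConnectedComponent := by
  have e : {f : V → Fin k // ∀ u v, H.Adj u v → f u = f v} ≃ (H.ConnectedComponent → Fin k) :=
    { toFun := fun f => ConnectedComponent.lift f.1 (fun v w p _ => by
        clear * - p
        induction p with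
        | nil => rfl
        | cons h p ih => exact (f.2 _ _ h).trans ih)
      invFun := fun g => ⟨fun v => g (H.connectedComponentMk v), fun u v h => by
        exact congrArg g (ConnectedComponent.connectedComponentMk_eq_of_adj h)⟩
      left_inv := fun f => by ext v; rfl
      right_inv := fun g => by
        funext c
        induction c using ConnectedComponent.ind
        rfl }
  rw [Nat.card_congr e, Nat.card_fun, Nat.card_fin]

/-- The number of proper colourings with `k` colours is a polynomial in `k`: there is exactly
one real polynomial whose value at every positive integer `k` is the number of proper
`k`-colourings of the finite graph `G`. -/
theorem existsUnique_chromaticPolynomial {V : Type*} [Finite V] (G : SimpleGraph V) :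
    ∃! p : Polynomial ℝ, ∀ k : ℕ, 0 < k → p.eval (k : ℝ) = Nat.card (G.Coloring (Fin k)) := by
  classical
  have := Fintype.ofFinite V
  refine existsUnique_of_exists_of_unique ?_ ?_
  · refine ⟨∑ A ∈ G.edgeFinset.powerset, (-1) ^ A.card *
      Polynomial.X ^ Nat.card (fromEdgeSet (A : Set (Sym2 V))).ConnectedComponent, ?_⟩
    intro k _
    have mono : ∀ (f : V → Fin k) (A : Finset (Sym2 V)), A ∈ G.edgeFinset.powerset →
        ((∀ e ∈ A, (e.map f).IsDiag) ↔
          ∀ u v, (fromEdgeSet (A : Set (Sym2 V))).Adj u v → f u = f v) := by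
      intro f A hA
      constructor
      · intro h u v huv
        rw [fromEdgeSet_adj] at huv
        simpa using h _ huv.1
      · intro h e he
        have heG : e ∈ G.edgeSet := by
          simpa using Finset.mem_powerset.mp hA he
        induction e with
        | h u v =>
          have : u ≠ v := by
            rintro rfl
            simp at heG
          simpa using h u v (by simp [this, he])
    have col : ∀ f : V → Fin k, (∀ u v, G.Adj u v → f u ≠ f v) ↔
        ∀ e ∈ G.edgeFinset, ¬ (e.map f).IsDiag := by
      intro f
      constructor
      · intro h e he
        induction e with
        | h u v => simpa using h u v (by simpa using he)
      · intro h u v huv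
        simpa using h s(u, v) (by simpa using huv)
    have e : G.Coloring (Fin k) ≃ {f : V → Fin k // ∀ u v, G.Adj u v → f u ≠ f v} :=
      { toFun := fun C => ⟨C, fun u v h => C.valid h⟩
        invFun := fun f => Coloring.mk f.1 (fun {u v} h => f.2 u v h)
        left_inv := fun C => by ext v; rfl
        right_inv := fun f => by ext v; rfl }
    rw [Nat.card_congr e, Nat.card_eq_fintype_card, Fintype.card_subtype, Finset.card_filter]
    push_cast
    have key : ∀ f : V → Fin k, (if (∀ u v, G.Adj u v → f u ≠ f v) then (1 : ℝ) else 0) =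
        ∑ A ∈ G.edgeFinset.powerset, (-1) ^ A.card *
          (if (∀ u v, (fromEdgeSet (A : Set (Sym2 V))).Adj u v → f u = f v)
            then (1 : ℝ) else 0) := by
      intro f
      have h1 : (if (∀ u v, G.Adj u v → f u ≠ f v) then (1 : ℝ) else 0) =
          ∏ e ∈ G.edgeFinset, (-(if (e.map f).IsDiag then (1 : ℝ) else 0) + 1) := by
        rw [if_congr (col f) rfl rfl]
        refine Eq.trans ?_ ((Finset.prod_boole (s := G.edgeFinset)
          (p := fun e => ¬ (e.map f).IsDiag)).symm.trans (Finset.prod_congr rfl fun e _ => ?_))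
        · congr
        · by_cases h : (e.map f).IsDiag <;> simp [h]
      rw [h1, Finset.prod_add_one]
      refine Finset.sum_congr rfl fun A hA => ?_
      rw [Finset.prod_neg, Finset.prod_boole]
      congr 1
      by_cases h : ∀ e ∈ A, (e.map f).IsDiag
      · rw [if_pos h, if_pos ((mono f A hA).1 h)]
      · rw [if_neg h, if_neg fun h' => h ((mono f A hA).2 h')]
    rw [Finset.sum_congr rfl fun f _ => key f, Finset.sum_comm, Polynomial.eval_finsetSum]
    refine Finset.sum_congr rfl fun A _ => ?_
    rw [← Finset.mul_sum, Finset.sum_boole, ← Fintype.card_subtype, ← Nat.card_eq_fintype_card,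
      card_maps_constant_on_edges]
    simp
  · intro p q hp hq
    refine Polynomial.eq_of_infinite_eval_eq p q ?_
    refine Set.Infinite.mono ?_ (Set.infinite_range_of_injective
      (f := fun n : ℕ => ((n + 1 : ℕ) : ℝ)) fun a b h => by simpa using h)
    rintro _ ⟨n, rfl⟩
    exact (hp _ n.succ_pos).trans (hq _ n.succ_pos).symm

/-- The chromatic polynomial `P(G, x)` of a finite graph `G`: the unique real polynomial such
that `P(G, k)` is the number of proper `k`-colourings of `G` for every positive integer `k`. -/
noncomputable def chromaticPolynomial {V : Type*} [Finite V] (G : SimpleGraph V) :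
    Polynomial ℝ :=
  (existsUnique_chromaticPolynomial G).choose

theorem chromaticPolynomial_eval {V : Type*} [Finite V] (G : SimpleGraph V) (k : ℕ)
    (hk : 0 < k) :
    G.chromaticPolynomial.eval (k : ℝ) = Nat.card (G.Coloring (Fin k)) :=
  (existsUnique_chromaticPolynomial G).choose_spec.1 k hk

/-- The function `ε(G, x) = P'(G, x) / P(G, x)`. -/
noncomputable def chromaticEpsilon {V : Type*} [Finite V] (G : SimpleGraph V) (x : ℝ) : ℝ :=
  G.chromaticPolynomial.derivative.eval x / G.chromaticPolynomial.eval x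

/-- A graph is chordal if no cycle `C` on at least four vertices is an induced subgraph, i.e.
every cycle of length at least four has a chord. -/
def IsChordal {V : Type*} (Q : SimpleGraph V) : Prop :=
  ∀ (u : V) (C : Q.Walk u u), C.IsCycle → 4 ≤ C.length → ¬ C.toSubgraph.IsInduced

end SimpleGraph

/-!
Every `G` on `n` vertices satisfies `(-1) ^ n * P(G, x) > 0` for `x < 0`, by deletion–contraction.
Rewriting `P(G) = P(G - uv) - P(G / uv)` as a sum of two numbers of the same sign, `ε(G)` becomes a
weighted mean of `ε(G - uv)` and `ε(G / uv)`.

By Dirac's theorem `Q` has a simplicial vertex `v`, of degree `d` say; then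
`P(Q, x) = (x - d) P(Q - v, x)`, so `ε(Q) = 1 / (x - d) + ε(Q - v) < ε(Q - v)`. If `v` has the same
neighbours in `G`, the same formula holds for `G` and the inequality reduces to `Q - v < G - v`.
Otherwise `G` has an edge `uv` outside `Q`, and `ε(Q) ≤ ε(G - uv)` and
`ε(Q) < ε(Q - v) ≤ ε(G / uv)` by induction, so `ε(Q)` lies below the weighted mean `ε(G)`.
-/

namespace ChromaticEpsilon

open SimpleGraph Polynomial

variable {V : Type*}

theorem isChordless_of_length_eq_dist {G : SimpleGraph V} {s t : V} {p : G.Walk s t}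
    (hp : p.length = G.dist s t) : p.IsChordless := by
  have mem_edges_of_le {i j : ℕ} (hij : i ≤ j) (hj : j ≤ p.length)
      (hadj : G.Adj (p.getVert i) (p.getVert j)) : s(p.getVert i, p.getVert j) ∈ p.edges := by
    have hne : i ≠ j := by
      rintro rfl
      exact hadj.ne rfl
    have shortcut : p.length ≤ ((p.take i).append (.cons hadj (p.drop j))).length :=
      hp.trans_le (dist_le _)
    rw [Walk.length_append, Walk.length_cons, Walk.take_length, Walk.drop_length] at shortcut
    obtain rfl : j = i + 1 := by lia
    exact p.mem_edges_toSubgraph.mp (p.toSubgraph_adj_getVert (by lia))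
  refine Walk.isChordless_iff_forall_mem_edges.mpr fun a b ha hb hab => ?_
  obtain ⟨i, rfl, hi⟩ := Walk.mem_support_iff_exists_getVert.mp ha
  obtain ⟨j, rfl, hj⟩ := Walk.mem_support_iff_exists_getVert.mp hb
  rcases le_total i j with hij | hji
  · exact mem_edges_of_le hij hj hab
  · exact Sym2.eq_swap ▸ mem_edges_of_le hji hi hab.symm

theorem isChordless_map {W : Type*} {G : SimpleGraph V} {H : SimpleGraph W} (f : G ↪g H) {s t : V}
    {p : G.Walk s t} (hp : p.IsChordless) : (p.map f.toHom).IsChordless := by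
  refine Walk.isChordless_iff_forall_mem_edges.mpr fun a b ha hb hab => ?_
  rw [Walk.support_map, List.mem_map] at ha hb
  obtain ⟨a, ha, rfl⟩ := ha
  obtain ⟨b, hb, rfl⟩ := hb
  rw [Walk.edges_map]
  exact List.mem_map_of_mem (hp.mem_edges ha hb (f.map_adj_iff.mp hab))

theorem isChordless_cons_concat {G : SimpleGraph V} {v s t : V} {p : G.Walk s t}
    (hp : p.IsChordless) (hvs : G.Adj v s) (htv : G.Adj t v)
    (hv : ∀ a ∈ p.support, G.Adj v a → a = s ∨ a = t) :
    (Walk.cons hvs (p.concat htv)).IsChordless := by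
  have mem_edges_of_adj {a : V} (ha : a ∈ p.support) (hva : G.Adj v a) :
      s(v, a) ∈ (Walk.cons hvs (p.concat htv)).edges := by
    rcases hv a ha hva with rfl | rfl <;> simp [Sym2.eq_swap]
  refine Walk.isChordless_iff_forall_mem_edges.mpr fun a b ha hb hab => ?_
  have eq_or_mem {c : V} (hc : c ∈ (Walk.cons hvs (p.concat htv)).support) :
      c = v ∨ c ∈ p.support := by
    simp only [Walk.support_cons, Walk.support_concat, List.mem_cons, List.mem_append,
      List.not_mem_nil, or_false] at hc
    tauto
  rcases eq_or_mem ha with rfl | ha' <;> rcases eq_or_mem hb with rfl | hb'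
  · exact absurd rfl hab.ne
  · exact mem_edges_of_adj hb' hab
  · exact Sym2.eq_swap ▸ mem_edges_of_adj ha' hab.symm
  · simp [hp.mem_edges ha' hb' hab]

theorem isCycle_cons_concat {G : SimpleGraph V} {v s t : V} {p : G.Walk s t} (hp : p.IsPath)
    (hst : s ≠ t) (hv : v ∉ p.support) (hvs : G.Adj v s) (htv : G.Adj t v) :
    (Walk.cons hvs (p.concat htv)).IsCycle := by
  refine Walk.cons_isCycle_iff _ _ |>.mpr ⟨hp.concat hv htv, ?_⟩
  rw [Walk.edges_concat, List.concat_eq_append, List.mem_append, List.mem_singleton, not_or]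
  refine ⟨fun h => hv (p.fst_mem_support_of_mem_edges h), fun h => ?_⟩
  rcases Sym2.eq_iff.mp h with ⟨hvt, -⟩ | ⟨-, hst'⟩
  · exact htv.ne' hvt
  · exact hst hst'

theorem isChordal_comap {W : Type*} {G : SimpleGraph V} (hG : G.IsChordal) (f : W ↪ V) :
    (G.comap f).IsChordal := by
  intro u C hC hlen hind
  refine hG _ (C.map (Embedding.comap f G).toHom) (hC.map f.injective)
    (hlen.trans_eq (Walk.length_map _ _).symm) ?_
  rw [Walk.isInduced_toSubgraph] at hind ⊢
  exact isChordless_map _ hind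

/-- A vertex is simplicial if its neighbours are pairwise adjacent. -/
def IsSimplicial (G : SimpleGraph V) (v : V) : Prop :=
  G.IsClique (G.neighborSet v)

theorem IsSimplicial.of_induce {G : SimpleGraph V} {W : Set V} {w : W}
    (hw : IsSimplicial (G.induce W) w) (hW : G.neighborSet w ⊆ W) : IsSimplicial G w :=
  fun a ha b hb hab => hw (x := ⟨a, hW ha⟩) ha (y := ⟨b, hW hb⟩) hb (Subtype.coe_ne_coe.mp hab)

theorem exists_isPath_isChordless_of_induce_reachable {G : SimpleGraph V} {W : Set V} {s t : W}
    (hr : (G.induce W).Reachable s t) :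
    ∃ p : G.Walk s t, p.IsPath ∧ p.IsChordless ∧ ∀ a ∈ p.support, a ∈ W := by
  obtain ⟨p, hp, hlen⟩ := hr.exists_path_of_dist
  refine ⟨p.map (Embedding.induce W).toHom, hp.map Subtype.val_injective,
    isChordless_map _ (isChordless_of_length_eq_dist hlen), fun a ha => ?_⟩
  obtain ⟨a, -, rfl⟩ := List.mem_map.mp (Walk.support_map (Embedding.induce W).toHom p ▸ ha)
  exact a.2

theorem adj_of_induce_reachable {G : SimpleGraph V} (hG : G.IsChordal) {v s t : V}
    (hvs : G.Adj v s) (hvt : G.Adj v t) (hst : s ≠ t) {W : Set V} (hsW : s ∈ W) (htW : t ∈ W)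
    (hW : W ∩ insert v (G.neighborSet v) ⊆ {s, t})
    (hr : (G.induce W).Reachable ⟨s, hsW⟩ ⟨t, htW⟩) : G.Adj s t := by
  by_contra hnadj
  obtain ⟨p, hp, hp_chordless, hpW⟩ := exists_isPath_isChordless_of_induce_reachable hr
  have hvW : v ∉ W := fun h => by
    rcases hW ⟨h, Set.mem_insert _ _⟩ with rfl | rfl
    · exact hvs.ne rfl
    · exact hvt.ne rfl
  have two_le_length : 2 ≤ p.length := by
    by_contra! hlt
    interval_cases h : p.length
    · exact hst (Walk.eq_of_length_eq_zero h)
    · exact hnadj (Walk.adj_of_length_eq_one h)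
  have hcycle := isCycle_cons_concat hp hst (fun h => hvW (hpW v h)) hvs hvt.symm
  refine hG v _ hcycle ?_ (Walk.isInduced_toSubgraph.mpr ?_)
  · rw [Walk.length_cons, Walk.length_concat]
    lia
  · exact isChordless_cons_concat hp_chordless hvs hvt.symm fun a ha hva =>
      hW ⟨hpW a ha, Set.mem_insert_of_mem v hva⟩

-- Two nonadjacent vertices of the boundary are joined by a shortest path through `C`, which closes
-- up at `v` to a chordless cycle.
theorem isClique_boundary_componentCompl {G : SimpleGraph V} (hG : G.IsChordal) {v : V}
    (C : G.ComponentCompl (insert v (G.neighborSet v))) :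
    G.IsClique {s | s ∉ C ∧ ∃ c ∈ C, G.Adj c s} := by
  have adj_of_mem {s : V} (hs : s ∉ C ∧ ∃ c ∈ C, G.Adj c s) : G.Adj v s := by
    obtain ⟨hsC, c, hc, hcs⟩ := hs
    have hsN : s ∈ insert v (G.neighborSet v) := by
      by_contra hsN
      exact hsC (C.mem_of_adj c s hc hsN hcs)
    refine hsN.resolve_left ?_
    rintro rfl
    exact C.notMem_of_mem hc (Set.mem_insert_of_mem _ hcs.symm)
  rintro s hs t ht hst
  have hvs := adj_of_mem hs
  have hvt := adj_of_mem ht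
  obtain ⟨-, c, hc, hcs⟩ := hs
  obtain ⟨-, d, hd, hdt⟩ := ht
  let W : Set V := (insert v (G.neighborSet v))ᶜ ∪ {s, t}
  have hNW : (insert v (G.neighborSet v))ᶜ ⊆ W := Set.subset_union_left
  refine adj_of_induce_reachable hG hvs hvt hst (W := W) (by simp [W]) (by simp [W]) ?_ ?_
  · rintro a ⟨haN | ha, haN'⟩
    · exact absurd haN' haN
    · exact ha
  · obtain ⟨hcN, hcC⟩ := hc
    obtain ⟨hdN, hdC⟩ := hd
    have hsc : (G.induce W).Adj ⟨s, by simp [W]⟩ ⟨c, hNW hcN⟩ := hcs.symm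
    have hcd : (G.induce W).Reachable ⟨c, hNW hcN⟩ ⟨d, hNW hdN⟩ :=
      (ConnectedComponent.exact (hcC.trans hdC.symm)).map (induceHomOfLE G hNW).toHom
    have hdt : (G.induce W).Adj ⟨d, hNW hdN⟩ ⟨t, by simp [W]⟩ := hdt
    exact hsc.reachable.trans (hcd.trans hdt.reachable)

theorem exists_isClique_subset_insert_neighborSet {G : SimpleGraph V} (hG : G ≠ ⊤) {K : Set V}
    (hK : G.IsClique K) :
    ∃ v, K ⊆ insert v (G.neighborSet v) ∧ insert v (G.neighborSet v) ≠ Set.univ := by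
  by_cases! h : ∃ v ∈ K, insert v (G.neighborSet v) ≠ Set.univ
  · obtain ⟨v, hvK, hv⟩ := h
    refine ⟨v, fun w hw => ?_, hv⟩
    by_cases hwv : w = v
    · exact .inl hwv
    · exact .inr (hK hvK hw (Ne.symm hwv))
  · obtain ⟨v, a, hva, hnadj⟩ := G.ne_top_iff_exists_not_adj.mp hG
    refine ⟨v, fun w hw => ?_, fun hv => ?_⟩
    · rcases (h w hw).ge (Set.mem_univ v) with hvw | hwv
      · exact .inl hvw.symm
      · exact .inr hwv.symm
    · exact (hv.ge (Set.mem_univ a)).elim hva.symm hnadj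

-- Avoiding a clique `K` is what lets the induction go through: applied to `C` together with its
-- boundary `S`, which is a clique, it yields a vertex of `C`, whose neighbours all lie in `C ∪ S`.
theorem exists_isSimplicial_notMem [Finite V] {G : SimpleGraph V} (hG : G.IsChordal) {K : Set V}
    (hK : G.IsClique K) (hKV : K ≠ Set.univ) : ∃ w ∉ K, IsSimplicial G w := by
  induction hn : Nat.card V using Nat.strong_induction_on generalizing V with
  | h n ih =>
  subst hn
  rcases eq_or_ne G ⊤ with rfl | htop
  · obtain ⟨w, hw⟩ := (Set.ne_univ_iff_exists_notMem K).mp hKV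
    exact ⟨w, hw, fun a _ b _ hab => hab⟩
  obtain ⟨v, hKv, hv⟩ := exists_isClique_subset_insert_neighborSet htop hK
  obtain ⟨a, ha⟩ := (Set.ne_univ_iff_exists_notMem _).mp hv
  let C := G.componentComplMk ha
  let S : Set V := {s | s ∉ C ∧ ∃ c ∈ C, G.Adj c s}
  have hvS : v ∉ (C : Set V) ∪ S := by
    rintro (hvC | ⟨-, c, hc, hcv⟩)
    · exact C.notMem_of_mem hvC (Set.mem_insert _ _)
    · exact C.notMem_of_mem hc (Set.mem_insert_of_mem _ hcv.symm)
  have hS : (G.induce (C ∪ S)).IsClique ((↑) ⁻¹' S) := fun s hs t ht hst =>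
    isClique_boundary_componentCompl hG C hs ht (Subtype.coe_ne_coe.mpr hst)
  have hSW : ((↑) ⁻¹' S : Set ↥((C : Set V) ∪ S)) ≠ Set.univ :=
    (Set.ne_univ_iff_exists_notMem _).mpr
      ⟨⟨a, .inl (G.componentComplMk_mem ha)⟩, fun h => h.1 (G.componentComplMk_mem ha)⟩
  obtain ⟨⟨w, hwW⟩, hwS, hw⟩ :=
    ih _ (Finite.card_subtype_lt hvS) (isChordal_comap hG _) hS hSW rfl
  have hwC : w ∈ C := hwW.resolve_right hwS
  refine ⟨w, fun hwK => C.notMem_of_mem hwC (hKv hwK), hw.of_induce fun b hwb => ?_⟩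
  by_cases hbC : b ∈ C
  · exact .inl hbC
  · exact .inr ⟨hbC, w, hwC, hwb⟩

theorem exists_isSimplicial [Finite V] [Nonempty V] {G : SimpleGraph V} (hG : G.IsChordal) :
    ∃ v, IsSimplicial G v := by
  obtain ⟨v, -, hv⟩ := exists_isSimplicial_notMem hG isClique_empty Set.empty_ne_univ
  exact ⟨v, hv⟩

theorem chromaticPolynomial_eq_of_eval [Finite V] {G : SimpleGraph V} {p : ℝ[X]}
    (hp : ∀ k : ℕ, 0 < k → p.eval (k : ℝ) = Nat.card (G.Coloring (Fin k))) :
    G.chromaticPolynomial = p :=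
  (existsUnique_chromaticPolynomial G).unique G.chromaticPolynomial_eval hp

theorem chromaticPolynomial_bot [Finite V] :
    (⊥ : SimpleGraph V).chromaticPolynomial = X ^ Nat.card V := by
  refine chromaticPolynomial_eq_of_eval fun k _ => ?_
  let e : (⊥ : SimpleGraph V).Coloring (Fin k) ≃ (V → Fin k) :=
    { toFun := fun c => c
      invFun := fun f => Coloring.mk f fun h => h.elim }
  rw [Nat.card_congr e, Nat.card_fun, Nat.card_fin, eval_pow, eval_X, Nat.cast_pow]

section DeletionContraction

variable {α : Type*} {u v : V}

open Classical in
/-- The map identifying `v` with `u`. The merged vertex is called `u`, so that the contraction lives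
on the same vertex set as the deletion of `v`. -/
noncomputable def contractMap (h : u ≠ v) (w : V) : ({v}ᶜ : Set V) :=
  if hw : w = v then ⟨u, h⟩ else ⟨w, hw⟩

theorem contractMap_coe (h : u ≠ v) (w : ({v}ᶜ : Set V)) : contractMap h w = w :=
  dif_neg w.2

theorem apply_contractMap (h : u ≠ v) {f : V → α} (hf : f u = f v) (w : V) :
    f (contractMap h w) = f w := by
  unfold contractMap
  split_ifs with hw
  · exact hw ▸ hf
  · rfl

theorem contractMap_eq_iff (h : u ≠ v) {a b : V} :
    contractMap h a = contractMap h b ↔ a = b ∨ s(a, b) = s(u, v) := by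
  unfold contractMap
  split_ifs with ha hb hb <;> simp only [Sym2.eq_iff] <;> grind

/-- The graph `G / uv`, with the vertex `v` merged into `u`. -/
noncomputable def contract (G : SimpleGraph V) (h : u ≠ v) : SimpleGraph ({v}ᶜ : Set V) :=
  G.map (contractMap h)

theorem contract_adj {G : SimpleGraph V} (h : u ≠ v) {a b : ({v}ᶜ : Set V)} :
    (contract G h).Adj a b ↔
      ∃ a' b', (G.deleteEdges {s(u, v)}).Adj a' b' ∧
        contractMap h a' = a ∧ contractMap h b' = b := by
  constructor
  · rintro ⟨hne, a, b, hab, rfl, rfl⟩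
    exact ⟨a, b, deleteEdges_adj.mpr ⟨hab, fun he => hne ((contractMap_eq_iff h).mpr (.inr he))⟩,
      rfl, rfl⟩
  · rintro ⟨a, b, hab, rfl, rfl⟩
    obtain ⟨hab, he⟩ := deleteEdges_adj.mp hab
    exact ⟨fun heq => ((contractMap_eq_iff h).mp heq).elim hab.ne he, a, b, hab, rfl, rfl⟩

theorem deleteEdges_singleton_lt {G : SimpleGraph V} (huv : G.Adj u v) :
    G.deleteEdges {s(u, v)} < G :=
  (deleteEdges_le _).lt_of_not_ge fun h => (deleteEdges_adj.mp (h huv)).2 rfl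

theorem induce_compl_singleton_le_contract (G : SimpleGraph V) (h : u ≠ v) :
    G.induce {v}ᶜ ≤ contract G h :=
  fun a b hab => ⟨hab.ne, a, b, hab, contractMap_coe h a, contractMap_coe h b⟩

theorem card_coloring_deleteEdges_ne {G : SimpleGraph V} (huv : G.Adj u v) :
    Nat.card {c : (G.deleteEdges {s(u, v)}).Coloring α // c u ≠ c v} =
      Nat.card (G.Coloring α) := by
  refine Nat.card_congr
    { toFun := fun c => Coloring.mk c.1 fun {a b} hab => ?_
      invFun := fun c =>
        ⟨Coloring.mk c fun hab => c.valid (deleteEdges_le _ hab), c.valid huv⟩ }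
  by_cases h : s(a, b) = s(u, v)
  · rcases Sym2.eq_iff.mp h with ⟨rfl, rfl⟩ | ⟨rfl, rfl⟩
    · exact c.2
    · exact c.2.symm
  · exact c.1.valid (deleteEdges_adj.mpr ⟨hab, h⟩)

theorem card_coloring_deleteEdges_eq (G : SimpleGraph V) (h : u ≠ v) :
    Nat.card {c : (G.deleteEdges {s(u, v)}).Coloring α // c u = c v} =
      Nat.card ((contract G h).Coloring α) := by
  refine Nat.card_congr
    { toFun := fun c => Coloring.mk (fun w => c.1 w) fun {a b} hab => ?_
      invFun := fun c => ⟨Coloring.mk (fun w => c (contractMap h w)) fun {a b} hab =>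
        c.valid ((contract_adj h).mpr ⟨a, b, hab, rfl, rfl⟩), ?_⟩
      left_inv := fun c => Subtype.ext (RelHom.ext (apply_contractMap h c.2))
      right_inv := fun c => RelHom.ext fun w => congrArg c (contractMap_coe h w) }
  · obtain ⟨a, b, hab', rfl, rfl⟩ := (contract_adj h).mp hab
    rw [apply_contractMap h c.2, apply_contractMap h c.2]
    exact c.1.valid hab'
  · exact congrArg c ((contractMap_eq_iff h).mpr (.inr rfl))

theorem chromaticPolynomial_eq_sub [Finite V] {G : SimpleGraph V} (huv : G.Adj u v) :
    G.chromaticPolynomial =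
      (G.deleteEdges {s(u, v)}).chromaticPolynomial - (contract G huv.ne).chromaticPolynomial := by
  classical
  refine chromaticPolynomial_eq_of_eval fun k hk => ?_
  rw [eval_sub, chromaticPolynomial_eval _ k hk, chromaticPolynomial_eval _ k hk,
    sub_eq_iff_eq_add', ← card_coloring_deleteEdges_ne huv, ← card_coloring_deleteEdges_eq G huv.ne,
    ← Nat.cast_add, ← Nat.card_sum]
  exact congrArg _ (Nat.card_congr (Equiv.sumCompl _).symm)

end DeletionContraction

section Simplicial

variable {G : SimpleGraph V} {v : V} {α : Type*}

theorem exists_coloring_extending {c : (G.induce {v}ᶜ).Coloring α} {x : α}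
    (hx : x ∉ c '' ((↑) ⁻¹' G.neighborSet v)) :
    ∃ C : G.Coloring α, C v = x ∧ C.comp (Embedding.induce {v}ᶜ).toHom = c := by
  classical
  have ne_of_adj {w : V} (hw : w ≠ v) (hvw : G.Adj v w) : c ⟨w, hw⟩ ≠ x :=
    fun h => hx ⟨⟨w, hw⟩, hvw, h⟩
  refine ⟨Coloring.mk (fun w => if hw : w = v then x else c ⟨w, hw⟩) fun {a b} hab => ?_,
    dif_pos rfl, RelHom.ext fun w => dif_neg w.2⟩
  split_ifs with ha hb hb
  · exact absurd (ha.trans hb.symm) hab.ne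
  · exact (ne_of_adj hb (ha ▸ hab)).symm
  · exact ne_of_adj ha (hb ▸ hab.symm)
  · exact c.valid hab

theorem card_coloring_extending (c : (G.induce {v}ᶜ).Coloring α) :
    Nat.card {C : G.Coloring α // C.comp (Embedding.induce {v}ᶜ).toHom = c} =
      (c '' ((↑) ⁻¹' G.neighborSet v))ᶜ.ncard := by
  refine Nat.card_congr (.ofBijective (fun C => ⟨C.1 v, ?_⟩) ⟨?_, ?_⟩)
  · obtain ⟨C, rfl⟩ := C
    rintro ⟨w, hvw, hw⟩
    exact C.valid hvw hw.symm
  · rintro ⟨C, rfl⟩ ⟨D, hDC⟩ hv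
    refine Subtype.ext (RelHom.ext fun w => ?_)
    by_cases hw : w = v
    · exact hw ▸ congrArg Subtype.val hv
    · exact (DFunLike.congr_fun hDC ⟨w, hw⟩).symm
  · rintro ⟨x, hx⟩
    obtain ⟨C, hCv, hC⟩ := exists_coloring_extending hx
    exact ⟨⟨C, hC⟩, Subtype.ext hCv⟩

theorem IsSimplicial.ncard_image_coloring (hv : IsSimplicial G v)
    (c : (G.induce {v}ᶜ).Coloring α) :
    (c '' ((↑) ⁻¹' G.neighborSet v)).ncard = (G.neighborSet v).ncard := by
  have hc : Set.InjOn c ((↑) ⁻¹' G.neighborSet v) := fun a ha b hb hab => by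
    by_contra hne
    exact c.valid (hv ha hb (Subtype.coe_ne_coe.mpr hne)) hab
  rw [hc.ncard_image, Set.ncard_preimage_of_injective_subset_range Subtype.val_injective]
  exact fun w hw => ⟨⟨w, hw.ne'⟩, rfl⟩

theorem IsSimplicial.chromaticPolynomial_eq_mul [Finite V] (hv : IsSimplicial G v) :
    G.chromaticPolynomial =
      (X - C ((G.neighborSet v).ncard : ℝ)) * (G.induce {v}ᶜ).chromaticPolynomial := by
  refine chromaticPolynomial_eq_of_eval fun k hk => ?_
  have := Fintype.ofFinite ((G.induce {v}ᶜ).Coloring (Fin k))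
  have card_fiber (c : (G.induce {v}ᶜ).Coloring (Fin k)) :
      (Nat.card {C : G.Coloring (Fin k) // C.comp (Embedding.induce {v}ᶜ).toHom = c} : ℝ) =
        k - (G.neighborSet v).ncard := by
    rw [card_coloring_extending, ← hv.ncard_image_coloring c, eq_sub_iff_add_eq', ← Nat.cast_add,
      Set.ncard_add_ncard_compl, Nat.card_fin]
  rw [← Nat.card_congr (Equiv.sigmaFiberEquiv fun C : G.Coloring (Fin k) =>
      C.comp (Embedding.induce {v}ᶜ).toHom), Nat.card_sigma, Nat.cast_sum,
    Finset.sum_congr rfl fun c _ => card_fiber c, Finset.sum_const, Finset.card_univ,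
    ← Nat.card_eq_fintype_card, nsmul_eq_mul, mul_comm, eval_mul, chromaticPolynomial_eval _ k hk,
    eval_sub, eval_X, eval_C]

end Simplicial

theorem card_compl_singleton [Finite V] (v : V) :
    Nat.card ({v}ᶜ : Set V) + 1 = Nat.card V := by
  rw [Nat.card_coe_set_eq, add_comm, ← Set.ncard_singleton v, Set.ncard_add_ncard_compl]

section NegativeValues

variable [Finite V] {u v : V} {x : ℝ}

theorem neg_one_pow_mul_eval_chromaticPolynomial {G : SimpleGraph V} (huv : G.Adj u v) :
    (-1) ^ Nat.card V * G.chromaticPolynomial.eval x =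
      (-1) ^ Nat.card V * (G.deleteEdges {s(u, v)}).chromaticPolynomial.eval x +
        (-1) ^ Nat.card ({v}ᶜ : Set V) * (contract G huv.ne).chromaticPolynomial.eval x := by
  rw [chromaticPolynomial_eq_sub huv, eval_sub, ← card_compl_singleton v]
  ring

theorem neg_one_pow_mul_eval_derivative_chromaticPolynomial {G : SimpleGraph V}
    (huv : G.Adj u v) :
    (-1) ^ Nat.card V * G.chromaticPolynomial.derivative.eval x =
      (-1) ^ Nat.card V * (G.deleteEdges {s(u, v)}).chromaticPolynomial.derivative.eval x +
        (-1) ^ Nat.card ({v}ᶜ : Set V) *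
          (contract G huv.ne).chromaticPolynomial.derivative.eval x := by
  rw [chromaticPolynomial_eq_sub huv, derivative_sub, eval_sub, ← card_compl_singleton v]
  ring

theorem neg_one_pow_mul_eval_chromaticPolynomial_pos (G : SimpleGraph V) (hx : x < 0) :
    0 < (-1) ^ Nat.card V * G.chromaticPolynomial.eval x := by
  induction hn : Nat.card V using Nat.strong_induction_on generalizing V with
  | h n ih =>
  subst hn
  induction G using WellFoundedLT.induction with
  | ind G ihG =>
  rcases eq_or_ne G ⊥ with rfl | hG
  · rw [chromaticPolynomial_bot, eval_pow, eval_X, ← mul_pow, neg_one_mul]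
    exact pow_pos (neg_pos.mpr hx) _
  · obtain ⟨u, v, huv⟩ := ne_bot_iff_exists_adj.mp hG
    rw [neg_one_pow_mul_eval_chromaticPolynomial huv]
    exact add_pos (ihG _ (deleteEdges_singleton_lt huv))
      (ih _ (Nat.lt_of_succ_le (card_compl_singleton v).le) (contract G huv.ne) rfl)

theorem eval_chromaticPolynomial_ne_zero (G : SimpleGraph V) (hx : x < 0) :
    G.chromaticPolynomial.eval x ≠ 0 :=
  right_ne_zero_of_mul (neg_one_pow_mul_eval_chromaticPolynomial_pos G hx).ne'

theorem neg_one_pow_mul_eval_derivative_eq_chromaticEpsilon_mul (G : SimpleGraph V) (hx : x < 0) :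
    (-1) ^ Nat.card V * G.chromaticPolynomial.derivative.eval x =
      G.chromaticEpsilon x * ((-1) ^ Nat.card V * G.chromaticPolynomial.eval x) := by
  rw [chromaticEpsilon, mul_left_comm, div_mul_cancel₀ _ (eval_chromaticPolynomial_ne_zero G hx)]

theorem lt_chromaticEpsilon_of_le_of_lt {G : SimpleGraph V} (huv : G.Adj u v) (hx : x < 0) {r : ℝ}
    (hdelete : r ≤ (G.deleteEdges {s(u, v)}).chromaticEpsilon x)
    (hcontract : r < (contract G huv.ne).chromaticEpsilon x) : r < G.chromaticEpsilon x := by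
  refine lt_of_mul_lt_mul_right ?_ (neg_one_pow_mul_eval_chromaticPolynomial_pos G hx).le
  rw [← neg_one_pow_mul_eval_derivative_eq_chromaticEpsilon_mul G hx,
    neg_one_pow_mul_eval_derivative_chromaticPolynomial huv,
    neg_one_pow_mul_eval_chromaticPolynomial huv, mul_add,
    neg_one_pow_mul_eval_derivative_eq_chromaticEpsilon_mul _ hx,
    neg_one_pow_mul_eval_derivative_eq_chromaticEpsilon_mul _ hx]
  exact add_lt_add_of_le_of_lt
    (mul_le_mul_of_nonneg_right hdelete (neg_one_pow_mul_eval_chromaticPolynomial_pos _ hx).le)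
    (mul_lt_mul_of_pos_right hcontract (neg_one_pow_mul_eval_chromaticPolynomial_pos _ hx))

theorem IsSimplicial.chromaticEpsilon_eq_add {G : SimpleGraph V} (hv : IsSimplicial G v)
    (hx : x < 0) :
    G.chromaticEpsilon x =
      1 / (x - (G.neighborSet v).ncard) + (G.induce {v}ᶜ).chromaticEpsilon x := by
  have hd : x - (G.neighborSet v).ncard ≠ 0 := (sub_neg.mpr (hx.trans_le (Nat.cast_nonneg _))).ne
  have hP := eval_chromaticPolynomial_ne_zero (G.induce {v}ᶜ) hx
  rw [chromaticEpsilon, chromaticEpsilon, hv.chromaticPolynomial_eq_mul]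
  simp only [derivative_mul, derivative_sub, derivative_X, derivative_C, eval_add, eval_mul,
    eval_sub, eval_X, eval_C, sub_zero, eval_one]
  field_simp

theorem IsSimplicial.chromaticEpsilon_lt_induce {G : SimpleGraph V} (hv : IsSimplicial G v)
    (hx : x < 0) : G.chromaticEpsilon x < (G.induce {v}ᶜ).chromaticEpsilon x := by
  rw [hv.chromaticEpsilon_eq_add hx, add_lt_iff_neg_right, one_div_neg, sub_neg]
  exact hx.trans_le (Nat.cast_nonneg _)

end NegativeValues

theorem induce_compl_singleton_lt {G Q : SimpleGraph V} {v : V} (hQG : Q < G)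
    (hN : G.neighborSet v ⊆ Q.neighborSet v) : Q.induce {v}ᶜ < G.induce {v}ᶜ := by
  refine (comap_monotone _ hQG.le).lt_of_not_ge fun h => hQG.not_ge fun a b hab => ?_
  by_cases ha : a = v
  · subst ha
    exact hN hab
  by_cases hb : b = v
  · subst hb
    exact (hN hab.symm).symm
  exact h (show (G.induce {v}ᶜ).Adj ⟨a, ha⟩ ⟨b, hb⟩ from hab)

theorem IsSimplicial.chromaticEpsilon_lt_of_neighborSet_eq [Finite V] {G Q : SimpleGraph V} {v : V}
    {x : ℝ} (hv : IsSimplicial Q v) (hQG : Q ≤ G) (hN : G.neighborSet v = Q.neighborSet v)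
    (hx : x < 0)
    (h : (Q.induce {v}ᶜ).chromaticEpsilon x < (G.induce {v}ᶜ).chromaticEpsilon x) :
    Q.chromaticEpsilon x < G.chromaticEpsilon x := by
  have hvG : IsSimplicial G v := fun a ha b hb hab => hQG (hv (hN ▸ ha) (hN ▸ hb) hab)
  rw [hv.chromaticEpsilon_eq_add hx, hvG.chromaticEpsilon_eq_add hx, hN]
  exact add_lt_add_right h _

theorem chromaticEpsilon_lt_of_lt [Finite V] {G Q : SimpleGraph V} (hQ : Q.IsChordal)
    (hQG : Q < G) {x : ℝ} (hx : x < 0) : Q.chromaticEpsilon x < G.chromaticEpsilon x := by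
  induction hn : Nat.card V using Nat.strong_induction_on generalizing V with
  | h n ih =>
  subst hn
  induction G using WellFoundedLT.induction with
  | ind G ihG =>
  obtain ⟨a, -⟩ := ne_bot_iff_exists_adj.mp hQG.ne_bot
  have : Nonempty V := ⟨a⟩
  obtain ⟨v, hv⟩ := exists_isSimplicial hQ
  have ih_induce {H : SimpleGraph ({v}ᶜ : Set V)} (hH : Q.induce {v}ᶜ < H) :
      (Q.induce {v}ᶜ).chromaticEpsilon x < H.chromaticEpsilon x :=
    ih _ (Nat.lt_of_succ_le (card_compl_singleton v).le) (isChordal_comap hQ _) hH rfl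
  by_cases! hN : G.neighborSet v ⊆ Q.neighborSet v
  · exact hv.chromaticEpsilon_lt_of_neighborSet_eq hQG.le
      (hN.antisymm fun _ h => hQG.le h) hx (ih_induce (induce_compl_singleton_lt hQG hN))
  · obtain ⟨u, hvu, hvuQ⟩ := Set.not_subset.mp hN
    have huv : G.Adj u v := hvu.symm
    have hQ_le_delete : Q ≤ G.deleteEdges {s(u, v)} := fun a b hab =>
      deleteEdges_adj.mpr ⟨hQG.le hab, fun h => hvuQ ((Q.adj_congr_of_sym2 h).mp hab).symm⟩
    have hQ_le_contract : Q.induce {v}ᶜ ≤ contract G huv.ne :=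
      (comap_monotone _ hQG.le).trans (induce_compl_singleton_le_contract G huv.ne)
    refine lt_chromaticEpsilon_of_le_of_lt huv hx ?_
      ((hv.chromaticEpsilon_lt_induce hx).trans_le ?_)
    · rcases hQ_le_delete.eq_or_lt with heq | hlt
      · exact (congrArg (chromaticEpsilon · x) heq).le
      · exact (ihG _ (deleteEdges_singleton_lt huv) hlt).le
    · rcases hQ_le_contract.eq_or_lt with heq | hlt
      · exact (congrArg (chromaticEpsilon · x) heq).le
      · exact (ih_induce hlt).le

end ChromaticEpsilon

theorem mainTheorem2 {V : Type*} [Finite V] (G Q : SimpleGraph V)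
    (hQ : Q.IsChordal) (hQG : Q < G) (x : ℝ) (hx : x < 0) :
    G.chromaticPolynomial.eval x ≠ 0 ∧ Q.chromaticPolynomial.eval x ≠ 0 ∧
      G.chromaticEpsilon x > Q.chromaticEpsilon x :=
  ⟨ChromaticEpsilon.eval_chromaticPolynomial_ne_zero G hx,
    ChromaticEpsilon.eval_chromaticPolynomial_ne_zero Q hx,
    ChromaticEpsilon.chromaticEpsilon_lt_of_lt hQ hQG hx⟩
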